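/- For a nonzero polynomial $P \in \mathbb{C}[x_1, \dots, x_n]$ let \[ m(P) = \int_0^1 \cdots \int_0^1 \log\left|P(e^{2\pi i\theta_1}, \dots, e^{2\pi i\theta_n})\right| \, d\theta_1 \cdots d\theta_n \] be its (logarithmic) Mahler measure. Let $\chi_{-4}$ be the odd Dirichlet character modulo $4$, so that $\chi_{-4}(n) = 1$ for $n \equiv 1 \pmod 4$, $\chi_{-4}(n) = -1$ for $n \equiv 3 \pmod 4$ and $\chi_{-4}(n) = 0$ for even $n$, and let $L(\chi_{-4}, s) = \sum_{n \ge 1} \chi_{-4}(n) n^{-s}$ be its Dirichlet L-series. Then, for the polynomial $(1+x_1)(1+x)+(1-x_1)(1+y)z$ in the four variables $x_1, x, y, z$, the integral that defines its Mahler measure converges absolutely, and \[ m\bigl((1+x_1)(1+x)+(1-x_1)(1+y)z\bigr) = \frac{24}{\pi^3}\, L(\chi_{-4}, 4). \] -/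

import Mathlib

open MeasureTheory

/-- The point `(e^{2πiθ₁}, …, e^{2πiθₙ})` of the unit torus in `ℂⁿ`. -/
noncomputable def torusPoint {n : ℕ} (θ : Fin n → ℝ) : Fin n → ℂ :=
  fun i => Complex.exp (2 * Real.pi * Complex.I * θ i)

/-- The function `θ ↦ log |P(e^{2πiθ₁}, …, e^{2πiθₙ})|`, for a polynomial `P` in `n` variables. -/
noncomputable def logNormOnTorus {n : ℕ} (P : MvPolynomial (Fin n) ℂ) (θ : Fin n → ℝ) : ℝ :=
  Real.log ‖MvPolynomial.eval (torusPoint θ) P‖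

/-- The (logarithmic) Mahler measure of a polynomial in `n` variables:
the integral of `log |P(e^{2πiθ₁}, …, e^{2πiθₙ})|` over the unit cube `[0, 1]ⁿ`. -/
noncomputable def multivariateLogMahlerMeasure {n : ℕ} (P : MvPolynomial (Fin n) ℂ) : ℝ :=
  ∫ θ in Set.Icc (0 : Fin n → ℝ) 1, logNormOnTorus P θ

/-- The polynomial `(1 + x₁)(1 + x) + (1 - x₁)(1 + y)z`, in the four variables
`x₁ = X 0`, `x = X 1`, `y = X 2`, `z = X 3`. -/
noncomputable def fourVariablePolynomial : MvPolynomial (Fin 4) ℂ :=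
  (1 + MvPolynomial.X 0) * (1 + MvPolynomial.X 1)
    + (1 - MvPolynomial.X 0) * (1 + MvPolynomial.X 2) * MvPolynomial.X 3

/-- The odd Dirichlet character `χ₋₄` modulo `4` (`1 ↦ 1`, `3 ↦ -1`), with complex values. -/
noncomputable def chiNegFour : DirichletCharacter ℂ 4 :=
  ZMod.χ₄.ringHomComp (Int.castRingHom ℂ)

/-! On the torus the polynomial is `A + B z` with `A = (1+x₁)(1+x)` and `B = (1-x₁)(1+y)`. Jensen's
formula in `z` replaces the inner integral by `log|A| + log⁺(|B|/|A|)`, and `log|A|` integrates to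
0. Half-angle formulas give `|B|/|A| = a·r`, where `a` is a `|tan|` and `r` a quotient of two
independent `|cos|`. Their densities are `(2/π)/(1+a²)` and `(4/π²)·K(r)/r`, with `K(r) = ½
log((1+r)/|1-r|)`.

The remaining integral of `log⁺(a r)` is evaluated by Tonelli and explicit primitives: `a = 1/(r m)`
brings in `-log m`, `K` is written as the integral of `1/(1-t²)` over `0 < t < min(r, 1/r)`, and the
resulting arctangent difference is rewritten as an integral in a variable `v` that makes the
`t`-integral elementary (`lintegral_logRatio_mul_inv_one_add_sq`,
`lintegral_cauchy_logRatio_posLog`). What is left is `∫₀¹ (-log v)³/(2(1+v²)) dv = ½ Γ(4) L(χ₋₄,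
4)`, by the geometric series (`hasSum_mellin_exp`).

The evaluation uses lower Lebesgue integrals of nonnegative functions, so exchanging integrals
requires no integrability. Absolute convergence is proved separately, from the boundedness of the
polynomial on the torus and Jensen's formula. -/

open Set

/-! ### Tools for lower Lebesgue integrals -/

/-- Change of variables for the lower Lebesgue integral along a differentiable bijection between
subsets of `ℝ` with an explicit inverse. -/
theorem lintegral_eq_lintegral_abs_deriv_mul_of_invOn {f f' k : ℝ → ℝ} {s t : Set ℝ}
    (hs : MeasurableSet s) (hf' : ∀ x ∈ s, HasDerivAt f (f' x) x)
    (hst : MapsTo f s t) (hts : MapsTo k t s) (hkf : ∀ x ∈ s, k (f x) = x)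
    (hfk : ∀ y ∈ t, f (k y) = y) (u : ℝ → ENNReal) :
    ∫⁻ y in t, u y = ∫⁻ x in s, ENNReal.ofReal |f' x| * u (f x) := by
  have himg : f '' s = t := by
    ext y
    constructor
    · rintro ⟨x, hx, rfl⟩
      exact hst hx
    · intro hy
      exact ⟨k y, hts hy, hfk y hy⟩
  have hinj : InjOn f s := fun x hx y hy h => by rw [← hkf x hx, ← hkf y hy, h]
  rw [← himg]
  exact lintegral_image_eq_lintegral_abs_deriv_mul hs
    (fun x hx => (hf' x hx).hasDerivWithinAt) hinj u

/-- The fundamental theorem of calculus for nonnegative derivatives. -/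
theorem lintegral_Ioo_ofReal_deriv {F f : ℝ → ℝ} {a b : ℝ} (hab : a ≤ b)
    (hF : ContinuousOn F (Icc a b)) (hderiv : ∀ x ∈ Ioo a b, HasDerivAt F (f x) x)
    (hpos : ∀ x ∈ Ioo a b, 0 ≤ f x) :
    ∫⁻ x in Ioo a b, ENNReal.ofReal (f x) = ENNReal.ofReal (F b - F a) := by
  have hint : IntegrableOn f (Ioc a b) :=
    intervalIntegral.integrableOn_deriv_of_nonneg hF hderiv hpos
  have h := intervalIntegral.integral_eq_sub_of_hasDerivAt_of_le hab hF hderiv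
    ((intervalIntegrable_iff_integrableOn_Ioc_of_le hab).2 hint)
  rw [← h, intervalIntegral.integral_of_le hab, integral_Ioc_eq_integral_Ioo,
    ofReal_integral_eq_lintegral_ofReal (hint.mono_set Ioo_subset_Ioc_self)]
  exact (ae_restrict_iff' measurableSet_Ioo).2 (Filter.Eventually.of_forall hpos)

/-- Tonelli's theorem for a planar region described by its sections in both directions. -/
theorem lintegral_lintegral_swap_of_iff {A C : Set ℝ} {B D : ℝ → Set ℝ} {f : ℝ → ℝ → ENNReal}
    (hA : MeasurableSet A) (hC : MeasurableSet C) (hB : ∀ x, MeasurableSet (B x))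
    (hD : ∀ y, MeasurableSet (D y))
    (hS : MeasurableSet {p : ℝ × ℝ | p.1 ∈ A ∧ p.2 ∈ B p.1})
    (hiff : ∀ x y, (x ∈ A ∧ y ∈ B x) ↔ (y ∈ C ∧ x ∈ D y))
    (hf : Measurable (Function.uncurry f)) :
    ∫⁻ x in A, ∫⁻ y in B x, f x y = ∫⁻ y in C, ∫⁻ x in D y, f x y := by
  let g : ℝ → ℝ → ENNReal := fun x y =>
    {p : ℝ × ℝ | p.1 ∈ A ∧ p.2 ∈ B p.1}.indicator (Function.uncurry f) (x, y)
  have hg : Measurable (Function.uncurry g) := hf.indicator hS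
  have h1 : ∫⁻ x in A, ∫⁻ y in B x, f x y = ∫⁻ x, ∫⁻ y, g x y := by
    rw [← lintegral_indicator hA]
    refine lintegral_congr fun x => ?_
    by_cases hx : x ∈ A
    · rw [indicator_of_mem hx, ← lintegral_indicator (hB x)]
      refine lintegral_congr fun y => ?_
      by_cases hy : y ∈ B x <;> simp [g, indicator, hx, hy]
    · simp [g, indicator, hx]
  have h2 : ∫⁻ y in C, ∫⁻ x in D y, f x y = ∫⁻ y, ∫⁻ x, g x y := by
    rw [← lintegral_indicator hC]
    refine lintegral_congr fun y => ?_
    by_cases hy : y ∈ C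
    · rw [indicator_of_mem hy, ← lintegral_indicator (hD y)]
      refine lintegral_congr fun x => ?_
      have := hiff x y
      by_cases hx : x ∈ D y
      · have h3 := this.2 ⟨hy, hx⟩
        simp [g, indicator, hx, h3.1, h3.2]
      · have h3 : ¬ (x ∈ A ∧ y ∈ B x) := fun h => hx (this.1 h).2
        simp only [g, indicator, mem_ofPred_eq, hx, h3, if_false]
    · rw [indicator_of_notMem hy]
      symm
      rw [lintegral_eq_zero_iff' (by fun_prop)]
      refine Filter.Eventually.of_forall fun x => ?_
      have h3 : ¬ (x ∈ A ∧ y ∈ B x) := fun h => hy ((hiff x y).1 h).1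
      simp only [g, indicator, mem_ofPred_eq, h3, if_false]
      rfl
  rw [h1, h2, lintegral_lintegral_swap hg.aemeasurable]

/-- Folding an integral over `[0, 1]` of a function symmetric about `1 / 2`. -/
theorem lintegral_Icc_eq_two_mul_of_symm {h : ℝ → ENNReal} (hsymm : ∀ x, h (1 - x) = h x) :
    ∫⁻ x in Icc (0 : ℝ) 1, h x = 2 * ∫⁻ x in Ioo (0 : ℝ) (1 / 2), h x := by
  have h1 : ∫⁻ x in Ioo (1 / 2 : ℝ) 1, h x = ∫⁻ x in Ioo (0 : ℝ) (1 / 2), h x := by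
    rw [lintegral_eq_lintegral_abs_deriv_mul_of_invOn (f := fun x => 1 - x) (f' := fun _ => -1)
      (k := fun x => 1 - x) (s := Ioo 0 (1 / 2)) measurableSet_Ioo
      (fun x _ => by simpa using (hasDerivAt_id x).const_sub 1)
      (fun x hx => mem_Ioo.2 ⟨by linarith [hx.2], by linarith [hx.1]⟩)
      (fun x hx => mem_Ioo.2 ⟨by linarith [hx.2], by linarith [hx.1]⟩) (fun x _ => by ring)
      (fun x _ => by ring)]
    simp [hsymm]
  rw [setLIntegral_congr Ioc_ae_eq_Icc.symm,
    ← Ioc_union_Ioc_eq_Ioc (b := (1 / 2 : ℝ)) (by norm_num) (by norm_num),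
    lintegral_union measurableSet_Ioc (Ioc_disjoint_Ioc_of_le le_rfl),
    setLIntegral_congr Ioo_ae_eq_Ioc.symm, setLIntegral_congr (Ioo_ae_eq_Ioc (a := (1 / 2 : ℝ))).symm,
    h1, two_mul]

/-! ### Laws of `|cos|` and `|tan|` at a uniform angle -/

open Real in
/-- The distribution of `|cos (π θ)|` for `θ` uniform on `[0, 1]`. -/
theorem lintegral_abs_cos (g : ℝ → ENNReal) :
    ∫⁻ θ in Icc (0 : ℝ) 1, g |cos (π * θ)|
      = ENNReal.ofReal (2 / π) * ∫⁻ c in Ioo (0 : ℝ) 1, ENNReal.ofReal (1 / √(1 - c ^ 2)) * g c := by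
  rw [lintegral_Icc_eq_two_mul_of_symm
    (fun x => by rw [mul_sub, mul_one, cos_pi_sub, abs_neg]),
    lintegral_eq_lintegral_abs_deriv_mul_of_invOn (f := fun c => arccos c / π)
      (f' := fun c => -(1 / √(1 - c ^ 2)) / π) (k := fun θ => cos (π * θ)) (s := Ioo 0 1)
      measurableSet_Ioo]
  · rw [← lintegral_const_mul' _ _ (by simp), ← lintegral_const_mul' _ _ (by simp)]
    refine setLIntegral_congr_fun measurableSet_Ioo fun c hc => ?_
    have h1 : π * (arccos c / π) = arccos c := by field_simp
    simp only [h1]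
    rw [cos_arccos (by linarith [hc.1]) hc.2.le, abs_of_pos hc.1, ← mul_assoc, ← mul_assoc,
      show (2 : ENNReal) = ENNReal.ofReal 2 by simp, ← ENNReal.ofReal_mul (by norm_num),
      ← ENNReal.ofReal_mul (by positivity)]
    congr 2
    rw [neg_div, abs_neg, abs_of_nonneg (by positivity)]
    ring
  · intro c hc
    exact (hasDerivAt_arccos (by linarith [hc.1]) hc.2.ne).div_const π
  · intro c hc
    refine ⟨div_pos (arccos_pos.2 hc.2) pi_pos, ?_⟩
    have := arccos_lt_pi_div_two.2 hc.1
    rw [div_lt_iff₀ pi_pos]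
    linarith
  · intro θ hθ
    have h0 : 0 < π * θ := mul_pos pi_pos hθ.1
    have h1 : π * θ < π / 2 := by nlinarith [pi_pos, hθ.2]
    refine ⟨cos_pos_of_mem_Ioo ⟨by linarith, h1⟩, ?_⟩
    rw [← cos_zero]
    exact cos_lt_cos_of_nonneg_of_le_pi le_rfl (by linarith [pi_pos]) h0
  · intro c hc
    rw [show π * (arccos c / π) = arccos c by field_simp,
      cos_arccos (by linarith [hc.1]) hc.2.le]
  · intro θ hθ
    have h0 : 0 < π * θ := mul_pos pi_pos hθ.1
    have h1 : π * θ < π / 2 := by nlinarith [pi_pos, hθ.2]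
    rw [arccos_cos h0.le (by linarith [pi_pos])]
    field_simp

open Real in
/-- The distribution of `|tan (π θ)|` for `θ` uniform on `[0, 1]`. -/
theorem lintegral_abs_tan (g : ℝ → ENNReal) :
    ∫⁻ θ in Icc (0 : ℝ) 1, g |tan (π * θ)|
      = ENNReal.ofReal (2 / π) * ∫⁻ a in Ioi (0 : ℝ), ENNReal.ofReal (1 / (1 + a ^ 2)) * g a := by
  rw [lintegral_Icc_eq_two_mul_of_symm
    (fun x => by rw [mul_sub, mul_one, tan_pi_sub, abs_neg]),
    lintegral_eq_lintegral_abs_deriv_mul_of_invOn (f := fun c => arctan c / π)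
      (f' := fun c => 1 / (1 + c ^ 2) / π) (k := fun θ => tan (π * θ)) (s := Ioi 0)
      measurableSet_Ioi]
  · rw [← lintegral_const_mul' _ _ (by simp), ← lintegral_const_mul' _ _ (by simp)]
    refine setLIntegral_congr_fun measurableSet_Ioi fun c hc => ?_
    have h1 : π * (arctan c / π) = arctan c := by field_simp
    simp only [h1]
    rw [tan_arctan, abs_of_pos (mem_Ioi.1 hc), ← mul_assoc, ← mul_assoc,
      show (2 : ENNReal) = ENNReal.ofReal 2 by simp, ← ENNReal.ofReal_mul (by norm_num),
      ← ENNReal.ofReal_mul (by positivity)]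
    congr 2
    rw [abs_of_nonneg (by positivity)]
    ring
  · intro c hc
    exact (hasDerivAt_arctan c).div_const π
  · intro c hc
    refine ⟨div_pos (arctan_pos.2 hc) pi_pos, ?_⟩
    have := arctan_lt_pi_div_two c
    rw [div_lt_iff₀ pi_pos]
    linarith
  · intro θ hθ
    have h0 : 0 < π * θ := mul_pos pi_pos hθ.1
    have h1 : π * θ < π / 2 := by nlinarith [pi_pos, hθ.2]
    exact tan_pos_of_pos_of_lt_pi_div_two h0 h1
  · intro c hc
    rw [show π * (arctan c / π) = arctan c by field_simp, tan_arctan]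
  · intro θ hθ
    have h0 : 0 < π * θ := mul_pos pi_pos hθ.1
    have h1 : π * θ < π / 2 := by nlinarith [pi_pos, hθ.2]
    rw [arctan_tan (by linarith [pi_pos]) h1]
    field_simp

/-! ### The logarithmic kernel and the quotient of two cosines -/

open Real in
-- The primitive is `artanh`. Taking `s = min r r⁻¹` turns the logarithmic kernel into an integral
-- over `t`.
theorem lintegral_Ioo_one_div_one_sub_sq {s : ℝ} (h0 : 0 ≤ s) (h1 : s < 1) :
    ∫⁻ t in Ioo 0 s, ENNReal.ofReal (1 / (1 - t ^ 2))
      = ENNReal.ofReal (log ((1 + s) / (1 - s)) / 2) := by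
  rw [lintegral_Ioo_ofReal_deriv (F := fun t => (log (1 + t) - log (1 - t)) / 2) h0]
  · rw [log_div (by linarith) (by linarith)]
    simp
  · refine ContinuousOn.div_const (ContinuousOn.sub (ContinuousOn.log (by fun_prop) ?_)
      (ContinuousOn.log (by fun_prop) ?_)) _
    · intro t ht
      have := ht.1
      positivity
    · intro t ht
      have := ht.2
      exact (by linarith : 0 < 1 - t).ne'
  · intro t ht
    have ha : 1 + t ≠ 0 := by linarith [ht.1]
    have hb : 1 - t ≠ 0 := by linarith [ht.2]
    have hc : 1 - t ^ 2 ≠ 0 := by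
      rw [show 1 - t ^ 2 = (1 + t) * (1 - t) by ring]
      exact mul_ne_zero ha hb
    refine (((((hasDerivAt_id t).const_add 1).log ha).sub
      (((hasDerivAt_id t).const_sub 1).log hb)).div_const 2).congr_deriv ?_
    simp only [id]
    field_simp
    ring
  · intro t ht
    have : 0 < 1 - t ^ 2 := by nlinarith [ht.1, ht.2]
    positivity

/-- The quotient `(1 + r) / |1 - r|` is invariant under `r ↦ r⁻¹`, so `r` may be replaced by
whichever of the two is below 1. -/
theorem one_add_min_div_one_sub_min {r : ℝ} (h0 : 0 < r) (h1 : r ≠ 1) :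
    min r r⁻¹ < 1 ∧ (1 + min r r⁻¹) / (1 - min r r⁻¹) = (1 + r) / |1 - r| := by
  rcases lt_or_gt_of_ne h1 with h | h
  · have h2 : r ≤ r⁻¹ := h.le.trans ((one_le_inv₀ h0).2 h.le)
    rw [min_eq_left h2, abs_of_pos (by linarith)]
    exact ⟨h, rfl⟩
  · have h2 : r⁻¹ < 1 := inv_lt_one_of_one_lt₀ h
    rw [min_eq_right (h2.le.trans h.le), abs_of_neg (by linarith)]
    refine ⟨h2, ?_⟩
    have : r - 1 ≠ 0 := by linarith
    have : 1 - r⁻¹ ≠ 0 := by linarith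
    have : -(1 - r) ≠ 0 := by linarith
    field_simp
    ring

open Real in
-- A primitive is `-log(√(1-(rc)²) + r√(1-c²))/r`. At the upper endpoint exactly one of the two
-- roots vanishes; at `r = 1` both would, and the integral diverges.
theorem lintegral_sqrt_mul_sqrt {r : ℝ} (h0 : 0 < r) (h1 : r ≠ 1) :
    ∫⁻ c in Ioo 0 (min 1 r⁻¹), ENNReal.ofReal (c / (√(1 - c ^ 2) * √(1 - (r * c) ^ 2)))
      = ENNReal.ofReal (log ((1 + r) / |1 - r|) / 2 / r) := by
  have hm0 : 0 < min 1 r⁻¹ := lt_min one_pos (inv_pos.2 h0)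
  have key : ∀ c, 0 ≤ c → c < min 1 r⁻¹ → 0 < 1 - c ^ 2 ∧ 0 < 1 - (r * c) ^ 2 := by
    intro c hc hc'
    have h2 : c < 1 := hc'.trans_le (min_le_left _ _)
    have h3 : r * c < 1 := by
      have := hc'.trans_le (min_le_right _ _)
      calc r * c < r * r⁻¹ := by gcongr
        _ = 1 := mul_inv_cancel₀ h0.ne'
    constructor
    · nlinarith
    · have : 0 ≤ r * c := by positivity
      nlinarith
  have hpos : ∀ c ∈ Icc 0 (min 1 r⁻¹), 0 < √(1 - (r * c) ^ 2) + r * √(1 - c ^ 2) := by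
    intro c hc
    rcases lt_or_gt_of_ne h1 with h | h
    · have h2 : c ≤ 1 := hc.2.trans (min_le_left _ _)
      have h3 : r * c < 1 := by nlinarith [hc.1]
      have h4 : 0 ≤ r * c := mul_nonneg h0.le hc.1
      have : 0 < √(1 - (r * c) ^ 2) := sqrt_pos.2 (by nlinarith)
      positivity
    · have h2 : c ≤ r⁻¹ := hc.2.trans (min_le_right _ _)
      have h3 : c < 1 := h2.trans_lt (inv_lt_one_of_one_lt₀ h)
      have : 0 < √(1 - c ^ 2) := sqrt_pos.2 (by nlinarith [hc.1])
      positivity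
  rw [lintegral_Ioo_ofReal_deriv
    (F := fun c => -(log (√(1 - (r * c) ^ 2) + r * √(1 - c ^ 2)) / r)) hm0.le]
  · congr 1
    rcases lt_or_gt_of_ne h1 with h | h
    · rw [min_eq_left ((one_le_inv₀ h0).2 h.le), abs_of_pos (by linarith)]
      have h2 : 1 - r ^ 2 = (1 + r) * (1 - r) := by ring
      have h3 : 0 < 1 - r := by linarith
      simp only [mul_one, one_pow, sub_self, sqrt_zero, mul_zero, add_zero, sub_zero, sqrt_one,
        ne_eq, OfNat.ofNat_ne_zero, not_false_eq_true, zero_pow]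
      rw [log_sqrt (by nlinarith), h2, log_mul (by linarith) h3.ne', log_div (by linarith) h3.ne']
      field_simp
      ring
    · rw [min_eq_right (inv_le_one_of_one_le₀ h.le), abs_of_neg (by linarith)]
      have h2 : r * √(1 - r⁻¹ ^ 2) = √((r + 1) * (r - 1)) := by
        rw [← sqrt_sq h0.le, ← sqrt_mul (by positivity), sqrt_sq h0.le]
        congr 1
        field_simp
        ring
      have h3 : 0 < r - 1 := by linarith
      simp only [mul_inv_cancel₀ h0.ne', mul_one, one_pow, sub_self, sqrt_zero, mul_zero, zero_add,
        sub_zero, sqrt_one, ne_eq, OfNat.ofNat_ne_zero, not_false_eq_true, zero_pow, h2]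
      rw [log_sqrt (by nlinarith), neg_sub, log_mul (by linarith) h3.ne',
        log_div (by linarith) h3.ne', add_comm r 1]
      field_simp
      ring
  · exact (ContinuousOn.log (by fun_prop) fun c hc => (hpos c hc).ne').div_const r |>.neg
  · intro c hc
    obtain ⟨h2, h3⟩ := key c hc.1.le hc.2
    have h4 := hpos c (Ioo_subset_Icc_self hc)
    have h5 : HasDerivAt (fun c : ℝ => 1 - (r * c) ^ 2) (-(2 * (r * c) * r)) c := by
      have := ((((hasDerivAt_id c).const_mul r).pow 2).const_sub 1)
      simpa using this
    have h6 : HasDerivAt (fun c : ℝ => 1 - c ^ 2) (-(2 * c)) c := by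
      have := (((hasDerivAt_id c).pow 2).const_sub 1)
      simpa using this
    refine ((((h5.sqrt h3.ne').add ((h6.sqrt h2.ne').const_mul r)).log h4.ne').div_const
      r).neg.congr_deriv ?_
    have h7 : 0 < √(1 - c ^ 2) := sqrt_pos.2 h2
    have h8 : 0 < √(1 - (r * c) ^ 2) := sqrt_pos.2 h3
    simp only [Pi.add_apply]
    set A := √(1 - c ^ 2)
    set B := √(1 - (r * c) ^ 2)
    have : B + r * A ≠ 0 := h4.ne'
    field_simp
    ring
  · intro c hc
    have := hc.1.le
    positivity

open Real in
/-- The distribution of the quotient of two independent variables with density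
`1 / √(1 - c ^ 2)` on `(0, 1)`. -/
theorem lintegral_quotient_sqrt {g : ℝ → ENNReal} (hg : Measurable g) :
    ∫⁻ c in Ioo (0 : ℝ) 1, ENNReal.ofReal (1 / √(1 - c ^ 2)) *
        ∫⁻ d in Ioo (0 : ℝ) 1, ENNReal.ofReal (1 / √(1 - d ^ 2)) * g (d / c)
      = ∫⁻ r in Ioi (0 : ℝ), ENNReal.ofReal (log ((1 + r) / |1 - r|) / 2 / r) * g r := by
  have h1 : ∀ c ∈ Ioo (0 : ℝ) 1, ENNReal.ofReal (1 / √(1 - c ^ 2)) *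
        ∫⁻ d in Ioo (0 : ℝ) 1, ENNReal.ofReal (1 / √(1 - d ^ 2)) * g (d / c)
      = ∫⁻ r in Ioo 0 c⁻¹, ENNReal.ofReal (c / (√(1 - c ^ 2) * √(1 - (r * c) ^ 2))) * g r := by
    intro c hc
    have hc0 : 0 < c := hc.1
    -- For fixed `c`, substitute `d = r c`, so that the quotient becomes the variable.
    rw [lintegral_eq_lintegral_abs_deriv_mul_of_invOn (f := fun r => r * c) (f' := fun _ => c)
      (k := fun d => d / c) (s := Ioo 0 c⁻¹) measurableSet_Ioo]
    · rw [← lintegral_const_mul' _ _ (by simp)]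
      refine setLIntegral_congr_fun measurableSet_Ioo fun r hr => ?_
      rw [mul_div_cancel_right₀ _ hc0.ne', ← mul_assoc, ← mul_assoc,
        ← ENNReal.ofReal_mul (by positivity), ← ENNReal.ofReal_mul (by positivity),
        abs_of_pos hc0]
      congr 2
      rw [div_mul_eq_mul_div, one_mul, div_mul_div_comm, mul_one]
    · intro r _
      simpa using (hasDerivAt_id r).mul_const c
    · intro r hr
      refine mem_Ioo.2 ⟨mul_pos hr.1 hc0, ?_⟩
      calc r * c < c⁻¹ * c := by gcongr; exact hr.2
        _ = 1 := inv_mul_cancel₀ hc0.ne'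
    · intro d hd
      refine mem_Ioo.2 ⟨div_pos hd.1 hc0, ?_⟩
      rw [inv_eq_one_div]
      exact div_lt_div_of_pos_right hd.2 hc0
    · intro r _
      exact mul_div_cancel_right₀ _ hc0.ne'
    · intro d _
      exact div_mul_cancel₀ _ hc0.ne'
  rw [setLIntegral_congr_fun measurableSet_Ioo h1,
    lintegral_lintegral_swap_of_iff (C := Ioi 0) (D := fun r => Ioo 0 (min 1 r⁻¹))
      measurableSet_Ioo measurableSet_Ioi (fun _ => measurableSet_Ioo) (fun _ => measurableSet_Ioo)]
  · refine setLIntegral_congr_fun_ae measurableSet_Ioi ?_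
    filter_upwards [compl_mem_ae_iff.2 (measure_singleton (1 : ℝ))] with r hr1 hr0
    rw [lintegral_mul_const _ (by fun_prop), lintegral_sqrt_mul_sqrt hr0 hr1]
  · simp only [mem_Ioo]
    rw [measurableSet_setOfPred]
    fun_prop
  · intro c r
    simp only [mem_Ioo, mem_Ioi, lt_min_iff]
    constructor
    · rintro ⟨⟨h1, h2⟩, h3, h4⟩
      exact ⟨h3, h1, h2, (lt_inv_comm₀ h3 h1).1 h4⟩
    · rintro ⟨h3, h1, h2, h4⟩
      exact ⟨⟨h1, h2⟩, h3, (lt_inv_comm₀ h1 h3).1 h4⟩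
  · unfold Function.uncurry
    fun_prop

/-! ### Reduction to a single integral of a cubed logarithm -/

open Real in
-- The integrand vanishes for `a ≤ r⁻¹`; on the rest, `a = 1/(r μ)` turns `log⁺(a r)` into `-log μ`.
theorem lintegral_posLog_mul_cauchy {r : ℝ} (hr : 0 < r) :
    ∫⁻ a in Ioi (0 : ℝ), ENNReal.ofReal (1 / (1 + a ^ 2)) * ENNReal.ofReal (log⁺ (a * r))
      = ∫⁻ μ in Ioo (0 : ℝ) 1, ENNReal.ofReal (-log μ * (r / (1 + (r * μ) ^ 2))) := by
  have h1 : ∫⁻ a in Ioi (0 : ℝ), ENNReal.ofReal (1 / (1 + a ^ 2)) * ENNReal.ofReal (log⁺ (a * r))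
      = ∫⁻ a in Ioi r⁻¹, ENNReal.ofReal (1 / (1 + a ^ 2)) * ENNReal.ofReal (log⁺ (a * r)) := by
    rw [← Ioc_union_Ioi_eq_Ioi (inv_pos.2 hr).le,
      lintegral_union measurableSet_Ioi (Ioc_disjoint_Ioi le_rfl)]
    convert zero_add _
    rw [setLIntegral_congr_fun (g := fun _ => 0) measurableSet_Ioc, lintegral_zero]
    intro a ha
    have h2 : 0 < a := ha.1
    have h3 : a * r ≤ 1 := by
      calc a * r ≤ r⁻¹ * r := by gcongr; exact ha.2
        _ = 1 := inv_mul_cancel₀ hr.ne'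
    have h4 : log⁺ (a * r) = 0 := by
      rw [posLog_eq_zero_iff, abs_of_pos (by positivity)]
      exact h3
    simp [h4]
  rw [h1, lintegral_eq_lintegral_abs_deriv_mul_of_invOn (f := fun μ => (r * μ)⁻¹)
    (f' := fun μ => -r / (r * μ) ^ 2) (k := fun a => (r * a)⁻¹) (s := Ioo 0 1) measurableSet_Ioo]
  · refine setLIntegral_congr_fun measurableSet_Ioo fun μ hμ => ?_
    have h0 : 0 < μ := hμ.1
    have h2 : (r * μ)⁻¹ * r = μ⁻¹ := by field_simp
    have h3 : log⁺ (μ⁻¹) = -log μ := by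
      rw [posLog_eq_log, log_inv]
      rw [abs_of_pos (by positivity)]
      exact (one_le_inv₀ h0).2 hμ.2.le
    have h4 : log μ < 0 := log_neg h0 hμ.2
    rw [h2, h3, ← ENNReal.ofReal_mul (by positivity), ← ENNReal.ofReal_mul (by positivity),
      neg_div, abs_neg, abs_of_pos (by positivity)]
    congr 1
    field_simp
    ring
  · intro μ hμ
    have h0 : 0 < μ := hμ.1
    have := ((hasDerivAt_id μ).const_mul r).inv (mul_pos hr h0).ne'
    simp only [id, mul_one] at this
    exact this
  · intro μ hμ
    have h0 : 0 < μ := hμ.1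
    have h1 : μ < 1 := hμ.2
    rw [mem_Ioi]
    apply inv_strictAnti₀ (by positivity)
    nlinarith
  · intro a ha
    have h0 : r⁻¹ < a := ha
    have h1 : 0 < a := (inv_pos.2 hr).trans h0
    refine mem_Ioo.2 ⟨by positivity, inv_lt_one_of_one_lt₀ ?_⟩
    calc 1 = r * r⁻¹ := (mul_inv_cancel₀ hr.ne').symm
      _ < r * a := by gcongr
  · intro μ hμ
    have h0 : 0 < μ := hμ.1
    field_simp
  · intro a ha
    have h1 : 0 < a := (inv_pos.2 hr).trans ha
    field_simp

open Real in
theorem lintegral_Ioo_inv_one_add_sq {t m : ℝ} (ht0 : 0 < t) (ht1 : t < 1) (hm : 0 < m) (c : ℝ)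
    (hc : 0 ≤ c) :
    ∫⁻ r in Ioo t t⁻¹, ENNReal.ofReal (c / (1 + (r * m) ^ 2))
      = ENNReal.ofReal (c / m * (arctan (m / t) - arctan (m * t))) := by
  have h : t ≤ t⁻¹ := ht1.le.trans ((one_le_inv₀ ht0).2 ht1.le)
  rw [lintegral_Ioo_ofReal_deriv (F := fun r => c / m * arctan (r * m)) h (by fun_prop)]
  · rw [mul_sub, mul_comm m t, inv_mul_eq_div]
  · intro r _
    have := ((((hasDerivAt_id r).mul_const m)).arctan).const_mul (c / m)
    refine this.congr_deriv ?_
    simp only [id, one_mul]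
    field_simp
  · intro r _
    positivity

open Real in
-- The `v`-derivative of `arctan(v/t) - arctan(v t)` contains the factor `1 - t²`, which cancels the
-- prefactor and leaves a rational function that is easy to integrate in `t`.
theorem lintegral_Ioo_arctan_sub_arctan {t m : ℝ} (ht0 : 0 < t) (ht1 : t < 1) (hm0 : 0 < m)
    (hm1 : m < 1) :
    ∫⁻ v in Ioo 0 m, ENNReal.ofReal (t * (1 - v ^ 2) / ((1 + v ^ 2 * t ^ 2) * (v ^ 2 + t ^ 2)))
      = ENNReal.ofReal (1 / (1 - t ^ 2) * (arctan (m / t) - arctan (m * t))) := by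
  have h1 : 0 < 1 - t ^ 2 := by nlinarith
  rw [lintegral_Ioo_ofReal_deriv
    (F := fun v => 1 / (1 - t ^ 2) * (arctan (v / t) - arctan (v * t))) hm0.le (by fun_prop)]
  · simp
  · intro v hv
    have := ((((hasDerivAt_id v).div_const t).arctan).sub
      (((hasDerivAt_id v).mul_const t).arctan)).const_mul (1 / (1 - t ^ 2))
    refine this.congr_deriv ?_
    have h2 : 0 < v := hv.1
    simp only [id]
    field_simp
    ring
  · intro v hv
    have : 0 < 1 - v ^ 2 := by nlinarith [hv.1, hv.2]
    positivity

open Real in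
-- A primitive is `log((v²+t²)/(1+v²t²)) / (2(1+v²))`; it vanishes at `t = 1`, and `t = 0`
-- contributes `log v²`.
theorem lintegral_Ioo_mul_div_mul {v : ℝ} (hv0 : 0 < v) (hv1 : v < 1) :
    ∫⁻ t in Ioo (0 : ℝ) 1,
        ENNReal.ofReal (t * (1 - v ^ 2) / ((1 + v ^ 2 * t ^ 2) * (v ^ 2 + t ^ 2)))
      = ENNReal.ofReal (-log v / (1 + v ^ 2)) := by
  rw [lintegral_Ioo_ofReal_deriv
    (F := fun t => (log (v ^ 2 + t ^ 2) - log (1 + v ^ 2 * t ^ 2)) / (2 * (1 + v ^ 2)))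
    zero_le_one]
  · congr 1
    simp only [one_pow, mul_one, add_comm (v ^ 2) 1, sub_self, zero_div, ne_eq,
      OfNat.ofNat_ne_zero, not_false_eq_true, zero_pow, mul_zero, add_zero, log_one,
      sub_zero, log_pow]
    push_cast
    field_simp
    ring
  · refine ContinuousOn.div_const (ContinuousOn.sub (ContinuousOn.log (by fun_prop) ?_)
      (ContinuousOn.log (by fun_prop) ?_)) _
    · intro t _
      positivity
    · intro t _
      positivity
  · intro t ht
    have h0 : 0 < t := ht.1
    have h1 : HasDerivAt (fun t : ℝ => v ^ 2 + t ^ 2) (2 * t) t := by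
      simpa using ((hasDerivAt_id t).pow 2).const_add (v ^ 2)
    have h2 : HasDerivAt (fun t : ℝ => 1 + v ^ 2 * t ^ 2) (v ^ 2 * (2 * t)) t := by
      simpa using (((hasDerivAt_id t).pow 2).const_mul (v ^ 2)).const_add 1
    refine (((h1.log (by positivity)).sub (h2.log (by positivity))).div_const
      (2 * (1 + v ^ 2))).congr_deriv ?_
    field_simp
    ring
  · intro t ht
    have h0 : 0 < t := ht.1
    have : 0 < 1 - v ^ 2 := by nlinarith
    positivity

open Real in
theorem lintegral_Ioo_neg_log_div {v : ℝ} (hv0 : 0 < v) (hv1 : v < 1) :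
    ∫⁻ m in Ioo v 1, ENNReal.ofReal (-log m / m) = ENNReal.ofReal (log v ^ 2 / 2) := by
  rw [lintegral_Ioo_ofReal_deriv (F := fun m => -(log m ^ 2 / 2)) hv1.le]
  · simp
  · refine ContinuousOn.neg (ContinuousOn.div_const (ContinuousOn.pow (ContinuousOn.log
      (by fun_prop) ?_) 2) _)
    intro m hm
    exact (hv0.trans_le hm.1).ne'
  · intro m hm
    have h0 : 0 < m := hv0.trans hm.1
    refine (((hasDerivAt_log h0.ne').pow 2).div_const 2).neg.congr_deriv ?_
    field_simp
    ring
  · intro m hm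
    have h0 : 0 < m := hv0.trans hm.1
    have := log_neg h0 hm.2
    have : 0 ≤ -log m := by linarith
    positivity

open Real in
-- Two auxiliary variables remove the kernel: `t` expresses it as an integral, which makes the
-- `r`-integral an arctangent difference, and `v` expresses that difference so that `t` can be
-- integrated out.
theorem lintegral_logRatio_mul_inv_one_add_sq {m : ℝ} (hm0 : 0 < m) (hm1 : m < 1) :
    ∫⁻ r in Ioi (0 : ℝ), ENNReal.ofReal (log ((1 + r) / |1 - r|) / 2) *
        ENNReal.ofReal (-log m / (1 + (r * m) ^ 2))
      = ∫⁻ v in Ioo 0 m, ENNReal.ofReal (-log m / m) * ENNReal.ofReal (-log v / (1 + v ^ 2)) := by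
  have hlog : 0 < -log m := by linarith [log_neg hm0 hm1]
  calc
    _ = ∫⁻ r in Ioi (0 : ℝ), ∫⁻ t in Ioo 0 (min r r⁻¹), ENNReal.ofReal (1 / (1 - t ^ 2)) *
        ENNReal.ofReal (-log m / (1 + (r * m) ^ 2)) := by
      refine setLIntegral_congr_fun_ae measurableSet_Ioi ?_
      -- At `r = 1` the `t`-integral is infinite while the kernel takes the default value `log 0 =
      -- 0`; this point is null.
      filter_upwards [compl_mem_ae_iff.2 (measure_singleton (1 : ℝ))] with r hr1 hr0
      have hr0' : 0 < r := hr0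
      obtain ⟨h1, h2⟩ := one_add_min_div_one_sub_min hr0 hr1
      rw [lintegral_mul_const _ (by fun_prop),
        lintegral_Ioo_one_div_one_sub_sq (by positivity) h1, h2]
    _ = ∫⁻ t in Ioo (0 : ℝ) 1, ∫⁻ r in Ioo t t⁻¹, ENNReal.ofReal (1 / (1 - t ^ 2)) *
        ENNReal.ofReal (-log m / (1 + (r * m) ^ 2)) := by
      refine lintegral_lintegral_swap_of_iff measurableSet_Ioi measurableSet_Ioo
        (fun _ => measurableSet_Ioo) (fun _ => measurableSet_Ioo) ?_ ?_ ?_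
      · simp only [mem_Ioo, mem_Ioi]
        rw [measurableSet_setOfPred]
        fun_prop
      · intro r t
        simp only [mem_Ioo, mem_Ioi, lt_min_iff]
        constructor
        · rintro ⟨h1, h2, h3, h4⟩
          refine ⟨⟨h2, ?_⟩, h3, (lt_inv_comm₀ h2 h1).1 h4⟩
          by_contra! h
          have : r⁻¹ < 1 := inv_lt_one_of_one_lt₀ (h.trans_lt h3)
          linarith
        · rintro ⟨⟨h1, h2⟩, h3, h4⟩
          exact ⟨h1.trans h3, h1, h3, (lt_inv_comm₀ (h1.trans h3) h1).1 h4⟩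
      · unfold Function.uncurry
        fun_prop
    _ = ∫⁻ t in Ioo (0 : ℝ) 1, ∫⁻ v in Ioo 0 m, ENNReal.ofReal (-log m / m) *
        ENNReal.ofReal (t * (1 - v ^ 2) / ((1 + v ^ 2 * t ^ 2) * (v ^ 2 + t ^ 2))) := by
      refine setLIntegral_congr_fun measurableSet_Ioo fun t ht => ?_
      have ht1 : 0 < 1 - t ^ 2 := by nlinarith [ht.1, ht.2]
      rw [lintegral_const_mul' _ _ (by simp), lintegral_const_mul' _ _ (by simp),
        lintegral_Ioo_inv_one_add_sq ht.1 ht.2 hm0 _ hlog.le,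
        lintegral_Ioo_arctan_sub_arctan ht.1 ht.2 hm0 hm1, ← ENNReal.ofReal_mul (by positivity),
        ← ENNReal.ofReal_mul (by positivity)]
      congr 1
      ring
    _ = ∫⁻ v in Ioo 0 m, ∫⁻ t in Ioo (0 : ℝ) 1, ENNReal.ofReal (-log m / m) *
        ENNReal.ofReal (t * (1 - v ^ 2) / ((1 + v ^ 2 * t ^ 2) * (v ^ 2 + t ^ 2))) := by
      refine lintegral_lintegral_swap ?_
      unfold Function.uncurry
      fun_prop
    _ = _ := by
      refine setLIntegral_congr_fun measurableSet_Ioo fun v hv => ?_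
      rw [lintegral_const_mul' _ _ (by simp), lintegral_Ioo_mul_div_mul hv.1 (hv.2.trans hm1)]

open Real in
theorem lintegral_cauchy_logRatio_posLog :
    ∫⁻ a in Ioi (0 : ℝ), ENNReal.ofReal (1 / (1 + a ^ 2)) *
        ∫⁻ r in Ioi (0 : ℝ), ENNReal.ofReal (log ((1 + r) / |1 - r|) / 2 / r) *
          ENNReal.ofReal (log⁺ (a * r))
      = ∫⁻ v in Ioo (0 : ℝ) 1, ENNReal.ofReal ((-log v) ^ 3 / (2 * (1 + v ^ 2))) := by
  calc
    _ = ∫⁻ a in Ioi (0 : ℝ), ∫⁻ r in Ioi (0 : ℝ), ENNReal.ofReal (log ((1 + r) / |1 - r|) / 2 / r) *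
          (ENNReal.ofReal (1 / (1 + a ^ 2)) * ENNReal.ofReal (log⁺ (a * r))) := by
      refine setLIntegral_congr_fun measurableSet_Ioi fun a _ => ?_
      rw [← lintegral_const_mul' _ _ (by simp)]
      refine lintegral_congr fun r => ?_
      ring
    _ = ∫⁻ r in Ioi (0 : ℝ), ∫⁻ a in Ioi (0 : ℝ), ENNReal.ofReal (log ((1 + r) / |1 - r|) / 2 / r) *
          (ENNReal.ofReal (1 / (1 + a ^ 2)) * ENNReal.ofReal (log⁺ (a * r))) := by
      refine lintegral_lintegral_swap ?_
      unfold Function.uncurry posLog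
      fun_prop
    _ = ∫⁻ r in Ioi (0 : ℝ), ∫⁻ m in Ioo (0 : ℝ) 1, ENNReal.ofReal (log ((1 + r) / |1 - r|) / 2) *
          ENNReal.ofReal (-log m / (1 + (r * m) ^ 2)) := by
      refine setLIntegral_congr_fun measurableSet_Ioi fun r hr => ?_
      have hr0 : 0 < r := hr
      rw [lintegral_const_mul' _ _ (by simp), lintegral_posLog_mul_cauchy hr0,
        ← lintegral_const_mul' _ _ (by simp)]
      refine setLIntegral_congr_fun measurableSet_Ioo fun m hm => ?_
      have := log_neg hm.1 hm.2
      -- `ofReal_mul'` needs the sign of the second factor only, so none is required of the kernel.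
      rw [← ENNReal.ofReal_mul' (by have : 0 ≤ -log m := by linarith
                                    positivity),
        ← ENNReal.ofReal_mul' (by have : 0 ≤ -log m := by linarith
                                  positivity)]
      congr 1
      field_simp
    _ = ∫⁻ m in Ioo (0 : ℝ) 1, ∫⁻ r in Ioi (0 : ℝ), ENNReal.ofReal (log ((1 + r) / |1 - r|) / 2) *
          ENNReal.ofReal (-log m / (1 + (r * m) ^ 2)) := by
      refine lintegral_lintegral_swap ?_
      unfold Function.uncurry
      fun_prop
    _ = ∫⁻ m in Ioo (0 : ℝ) 1, ∫⁻ v in Ioo 0 m,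
          ENNReal.ofReal (-log m / m) * ENNReal.ofReal (-log v / (1 + v ^ 2)) :=
      setLIntegral_congr_fun measurableSet_Ioo fun m hm =>
        lintegral_logRatio_mul_inv_one_add_sq hm.1 hm.2
    -- Over the triangle `v < m < 1`, integrating `-log m / m` first supplies the other two powers
    -- of `log v`.
    _ = ∫⁻ v in Ioo (0 : ℝ) 1, ∫⁻ m in Ioo v 1,
          ENNReal.ofReal (-log m / m) * ENNReal.ofReal (-log v / (1 + v ^ 2)) := by
      refine lintegral_lintegral_swap_of_iff measurableSet_Ioo measurableSet_Ioo
        (fun _ => measurableSet_Ioo) (fun _ => measurableSet_Ioo) ?_ ?_ ?_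
      · simp only [mem_Ioo]
        rw [measurableSet_setOfPred]
        fun_prop
      · intro m v
        simp only [mem_Ioo]
        constructor
        · rintro ⟨⟨h1, h2⟩, h3, h4⟩
          exact ⟨⟨h3, h4.trans h2⟩, h4, h2⟩
        · rintro ⟨⟨h1, h2⟩, h3, h4⟩
          exact ⟨⟨h1.trans h3, h4⟩, h1, h3⟩
      · unfold Function.uncurry
        fun_prop
    _ = _ := by
      refine setLIntegral_congr_fun measurableSet_Ioo fun v hv => ?_
      rw [lintegral_mul_const' _ _ (by simp), lintegral_Ioo_neg_log_div hv.1 hv.2,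
        ← ENNReal.ofReal_mul (by positivity)]
      congr 1
      field_simp

/-! ### The L-value as a Mellin transform -/

theorem chiNegFour_two_mul_add_one (k : ℕ) : chiNegFour ((2 * k + 1 : ℕ) : ZMod 4) = (-1) ^ k := by
  have h : ZMod.χ₄ ((2 * k + 1 : ℕ) : ZMod 4) = (-1) ^ k := by
    rw [ZMod.χ₄_eq_neg_one_pow (by omega)]
    congr 1
    omega
  rw [chiNegFour, MulChar.ringHomComp_apply, h]
  simp

theorem chiNegFour_two_mul (k : ℕ) : chiNegFour ((2 * k : ℕ) : ZMod 4) = 0 := by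
  have h : ZMod.χ₄ ((2 * k : ℕ) : ZMod 4) = 0 := by
    rw [ZMod.χ₄_nat_eq_if_mod_four, if_pos (by omega)]
  rw [chiNegFour, MulChar.ringHomComp_apply, h]
  simp

theorem hasSum_LSeries_chiNegFour {z : ℂ}
    (h : HasSum (fun k : ℕ => (-1 : ℂ) ^ k / ((2 * k + 1 : ℝ) : ℂ) ^ (4 : ℂ)) z) :
    LSeries (fun n : ℕ => chiNegFour n) 4 = z := by
  have hinj : Function.Injective (fun k : ℕ => 2 * k + 1) := fun a b hab => by
    simp only at hab
    omega
  refine HasSum.tsum_eq ((hinj.hasSum_iff ?_).1 ?_)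
  · intro n hn
    rcases Nat.even_or_odd' n with ⟨k, rfl | rfl⟩
    · rw [LSeries.term_def, chiNegFour_two_mul]
      simp
    · exact absurd ⟨k, rfl⟩ hn
  · refine h.congr_fun ?_
    intro k
    simp only [Function.comp_apply]
    rw [LSeries.term_of_ne_zero (by omega), chiNegFour_two_mul_add_one]
    push_cast
    rfl

open Real in
theorem lintegral_Ioo_neg_log_pow_three :
    ∫⁻ v in Ioo (0 : ℝ) 1, ENNReal.ofReal ((-log v) ^ 3 / (2 * (1 + v ^ 2)))
      = ∫⁻ u in Ioi (0 : ℝ), ENNReal.ofReal (u ^ 3 * (exp (-u) / (1 + exp (-u) ^ 2)) / 2) := by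
  rw [lintegral_eq_lintegral_abs_deriv_mul_of_invOn (f := fun u => exp (-u))
    (f' := fun u => -exp (-u)) (k := fun v => -log v) (s := Ioi 0) measurableSet_Ioi]
  · refine setLIntegral_congr_fun measurableSet_Ioi fun u hu => ?_
    rw [log_exp, neg_neg, ← ENNReal.ofReal_mul (by positivity), abs_neg, abs_of_pos (exp_pos _)]
    congr 1
    field_simp
  · intro u _
    simpa using (hasDerivAt_neg u).exp
  · intro u hu
    refine mem_Ioo.2 ⟨exp_pos _, ?_⟩
    rw [exp_lt_one_iff]
    exact neg_lt_zero.2 hu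
  · intro v hv
    exact neg_pos.2 (log_neg hv.1 hv.2)
  · intro u _
    simp
  · intro v hv
    simp [exp_log hv.1]

open Real in
theorem integrableOn_pow_three_mul_exp :
    IntegrableOn (fun u : ℝ => u ^ 3 * (exp (-u) / (1 + exp (-u) ^ 2))) (Ioi 0) := by
  have h := GammaIntegral_convergent (s := 4) (by norm_num)
  refine Integrable.mono' h (by fun_prop) ?_
  refine (ae_restrict_iff' measurableSet_Ioi).2 (Filter.Eventually.of_forall fun u hu => ?_)
  have hu0 : 0 < u := hu
  rw [norm_of_nonneg (by positivity), mul_comm, show (4 : ℝ) - 1 = (3 : ℕ) by norm_num,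
    rpow_natCast]
  gcongr
  exact div_le_self (exp_pos _).le (by nlinarith [exp_pos (-u)])

open Real in
-- Expand `e^{-u}/(1+e^{-2u}) = Σ (-1)^k e^{-(2k+1)u}` and take the Mellin transform at 4 term by
-- term; the 6 is `Γ(4)`.
theorem hasSum_mellin_exp :
    HasSum (fun k : ℕ => (-1 : ℂ) ^ k / ((2 * k + 1 : ℝ) : ℂ) ^ (4 : ℂ))
      (((∫ u in Ioi (0 : ℝ), u ^ 3 * (exp (-u) / (1 + exp (-u) ^ 2))) / 6 : ℝ) : ℂ) := by
  have h := hasSum_mellin (a := fun k : ℕ => (-1 : ℂ) ^ k) (p := fun k : ℕ => (2 * k + 1 : ℝ))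
    (F := fun u => ((exp (-u) / (1 + exp (-u) ^ 2) : ℝ) : ℂ)) (s := 4)
    (fun k => Or.inr (by positivity)) (by norm_num) ?_ ?_
  · have hG : Complex.Gamma 4 = 6 := by
      rw [show (4 : ℂ) = (3 : ℕ) + 1 by norm_num, Complex.Gamma_nat_eq_factorial]
      norm_num [Nat.factorial]
    have hM : mellin (fun u => ((exp (-u) / (1 + exp (-u) ^ 2) : ℝ) : ℂ)) 4
        = ((∫ u in Ioi (0 : ℝ), u ^ 3 * (exp (-u) / (1 + exp (-u) ^ 2)) : ℝ) : ℂ) := by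
      rw [mellin, ← integral_complex_ofReal]
      refine setIntegral_congr_fun measurableSet_Ioi fun u hu => ?_
      rw [show (4 : ℂ) - 1 = ((3 : ℕ) : ℂ) by norm_num, Complex.cpow_natCast]
      push_cast
      rw [smul_eq_mul]
    rw [hM] at h
    rw [Complex.ofReal_div]
    refine (h.div_const 6).congr_fun fun k => ?_
    rw [hG]
    ring
  · intro u hu
    have hu0 : 0 < u := hu
    have h1 : ‖-(exp (-u) ^ 2)‖ < 1 := by
      rw [norm_neg, norm_of_nonneg (by positivity)]
      have : exp (-u) < 1 := exp_lt_one_iff.2 (by linarith)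
      nlinarith [exp_pos (-u)]
    have h2 := ((hasSum_geometric_of_norm_lt_one h1).mul_left (exp (-u)))
    rw [sub_neg_eq_add, ← div_eq_mul_inv] at h2
    refine (Complex.hasSum_ofReal.2 h2).congr_fun fun k => ?_
    have h3 : exp (-(2 * k + 1) * u) = exp (-u) * (exp (-u) ^ 2) ^ k := by
      rw [← pow_mul, ← exp_nat_mul, ← exp_add]
      congr 1
      push_cast
      ring
    rw [h3, neg_pow (exp (-u) ^ 2)]
    push_cast
    ring
  · have h1 : Summable fun k : ℕ => 1 / ((k + 1 : ℕ) : ℝ) ^ (4 : ℝ) :=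
      (summable_nat_add_iff 1).2 (summable_one_div_nat_rpow.2 (by norm_num))
    refine Summable.of_nonneg_of_le (fun k => by positivity) (fun k => ?_) h1
    simp only [norm_pow, norm_neg, norm_one, one_pow, Complex.re_ofNat]
    push_cast
    gcongr
    linarith [(Nat.cast_nonneg k : (0 : ℝ) ≤ k)]

open Real in
-- The substitution `v = e^{-u}` leads to the Mellin integral; the factor 3 is `Γ(4)/2`.
theorem toReal_lintegral_neg_log_pow_three :
    ((∫⁻ v in Ioo (0 : ℝ) 1, ENNReal.ofReal ((-log v) ^ 3 / (2 * (1 + v ^ 2)))).toReal : ℂ)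
      = 3 * LSeries (fun n : ℕ => chiNegFour n) 4 := by
  rw [lintegral_Ioo_neg_log_pow_three, hasSum_LSeries_chiNegFour hasSum_mellin_exp,
    ← integral_eq_lintegral_of_nonneg_ae]
  · rw [integral_div]
    push_cast
    ring
  · refine (ae_restrict_iff' measurableSet_Ioi).2 (Filter.Eventually.of_forall fun u hu => ?_)
    have hu0 : 0 < u := hu
    simp only [Pi.zero_apply]
    positivity
  · exact (integrableOn_pow_three_mul_exp.div_const 2).aestronglyMeasurable

/-! ### Jensen's formula on the unit circle -/

/-- The point `e^{2πix}` of the unit circle. -/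
noncomputable def unitExp (x : ℝ) : ℂ := Complex.exp (2 * Real.pi * Complex.I * x)

@[fun_prop]
theorem continuous_unitExp : Continuous unitExp := by
  unfold unitExp
  fun_prop

theorem norm_unitExp (x : ℝ) : ‖unitExp x‖ = 1 := by
  rw [unitExp, show 2 * (Real.pi : ℂ) * Complex.I * x = (2 * Real.pi * x : ℝ) * Complex.I by
    push_cast; ring]
  exact Complex.norm_exp_ofReal_mul_I _

theorem unitExp_eq_circleMap (x : ℝ) : unitExp x = circleMap 0 1 (2 * Real.pi * x) := by
  simp only [unitExp, circleMap, zero_add, Complex.ofReal_one, one_mul]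
  congr 1
  push_cast
  ring

theorem unitExp_eq_sq (x : ℝ) : unitExp x = Complex.exp (Real.pi * x * Complex.I) ^ 2 := by
  rw [unitExp, ← Complex.exp_nat_mul]
  congr 1
  push_cast
  ring

theorem norm_one_add_unitExp (x : ℝ) : ‖1 + unitExp x‖ = 2 * |Real.cos (Real.pi * x)| := by
  -- Factor out the half-angle exponential `e^{πix}`, of norm 1.
  have h : 1 + unitExp x
      = Complex.exp ((Real.pi * x : ℝ) * Complex.I) * (2 * Real.cos (Real.pi * x) : ℝ) := by
    push_cast
    rw [unitExp_eq_sq, Complex.two_cos, mul_add, ← Complex.exp_add, ← Complex.exp_add,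
      ← Complex.exp_nat_mul]
    simp only [neg_mul, add_neg_cancel, Complex.exp_zero]
    rw [add_comm]
    congr 2
    push_cast
    ring
  rw [h, norm_mul, Complex.norm_exp_ofReal_mul_I, one_mul, Complex.norm_real, Real.norm_eq_abs,
    abs_mul, abs_two]

theorem norm_one_sub_unitExp (x : ℝ) : ‖1 - unitExp x‖ = 2 * |Real.sin (Real.pi * x)| := by
  have h : 1 - unitExp x
      = Complex.exp ((Real.pi * x : ℝ) * Complex.I) * (-Complex.I)
        * (2 * Real.sin (Real.pi * x) : ℝ) := by
    push_cast
    rw [unitExp_eq_sq, Complex.two_sin]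
    have h1 : Complex.exp (Real.pi * x * Complex.I) * Complex.exp (-(Real.pi * x) * Complex.I)
        = 1 := by
      rw [← Complex.exp_add]
      simp
    linear_combination Complex.I ^ 2 * h1 +
      (1 - Complex.exp (Real.pi * x * Complex.I) ^ 2) * Complex.I_sq
  rw [h, norm_mul, norm_mul, Complex.norm_exp_ofReal_mul_I, norm_neg, Complex.norm_I, one_mul,
    one_mul, Complex.norm_real, Real.norm_eq_abs, abs_mul, abs_two]

/-- Lebesgue measure on `[0, 1]`. -/
noncomputable abbrev unitVolume : Measure ℝ := volume.restrict (Icc 0 1)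

instance : IsProbabilityMeasure unitVolume :=
  ⟨by simp⟩

/-- Jensen's formula for a polynomial of degree one. -/
theorem integrable_integral_log_norm_add_mul_unitExp {A B : ℂ} (hA : A ≠ 0) (hB : B ≠ 0) :
    Integrable (fun x => Real.log ‖A + B * unitExp x‖) unitVolume ∧
    ∫ x, Real.log ‖A + B * unitExp x‖ ∂unitVolume
      = Real.log ‖A‖ + Real.posLog (‖B‖ / ‖A‖) := by
  set p : Polynomial ℂ := Polynomial.C B * Polynomial.X + Polynomial.C A with hp
  have hev : (fun x => Real.log ‖A + B * unitExp x‖)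
      = fun x => (fun θ => Real.log ‖p.eval (circleMap 0 1 θ)‖) (2 * Real.pi * x) := by
    ext x
    rw [unitExp_eq_circleMap, hp]
    simp [add_comm]
  have hpi : 2 * Real.pi ≠ 0 := by positivity
  have hint := (Polynomial.intervalIntegrable_mahlerMeasure (p := p)).comp_mul_left
    (c := 2 * Real.pi)
  rw [zero_div, div_self hpi, ← hev, intervalIntegrable_iff_integrableOn_Icc_of_le zero_le_one]
    at hint
  refine ⟨hint, ?_⟩
  have hval := Polynomial.logMahlerMeasure_C_mul_X_add_C hB A
  rw [Polynomial.logMahlerMeasure_def, Real.circleAverage_def] at hval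
  rw [integral_Icc_eq_integral_Ioc, ← intervalIntegral.integral_of_le zero_le_one, hev,
    intervalIntegral.integral_comp_mul_left (fun θ => Real.log ‖p.eval (circleMap 0 1 θ)‖) hpi,
    mul_zero, mul_one, hval, norm_mul, norm_inv]
  have hA' : 0 < ‖A‖ := norm_pos_iff.2 hA
  have hB' : 0 < ‖B‖ := norm_pos_iff.2 hB
  have h1 : Real.log (‖B‖⁻¹ * ‖A‖) = Real.log ‖A‖ - Real.log ‖B‖ := by
    rw [Real.log_mul (by positivity) hA'.ne', Real.log_inv]
    ring
  -- Both expressions equal `max (log ‖A‖) (log ‖B‖)`, with the roles of `A` and `B` exchanged.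
  simp only [Real.posLog, h1, Real.log_div hB'.ne' hA'.ne']
  rcases le_total (Real.log ‖A‖) (Real.log ‖B‖) with h | h
  · rw [max_eq_left (by linarith), max_eq_right (by linarith)]
    ring
  · rw [max_eq_right (by linarith), max_eq_left (by linarith)]
    ring

theorem integrable_integral_log_norm_one_add_unitExp :
    Integrable (fun x => Real.log ‖1 + unitExp x‖) unitVolume ∧
    ∫ x, Real.log ‖1 + unitExp x‖ ∂unitVolume = 0 := by
  simpa using integrable_integral_log_norm_add_mul_unitExp (A := 1) (B := 1) (by simp) (by simp)

theorem integrable_log_norm_one_sub_unitExp :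
    Integrable (fun x => Real.log ‖1 - unitExp x‖) unitVolume := by
  simpa [sub_eq_add_neg] using
    (integrable_integral_log_norm_add_mul_unitExp (A := 1) (B := -1) (by simp) (by simp)).1

theorem ae_cos_ne_zero_and_sin_ne_zero :
    ∀ᵐ x ∂unitVolume, Real.cos (Real.pi * x) ≠ 0 ∧ Real.sin (Real.pi * x) ≠ 0 := by
  rw [ae_restrict_iff' measurableSet_Icc]
  filter_upwards [compl_mem_ae_iff.2 (measure_singleton (0 : ℝ)),
    compl_mem_ae_iff.2 (measure_singleton (1 : ℝ)),
    compl_mem_ae_iff.2 (measure_singleton (1 / 2 : ℝ))] with x h0 h1 h2 hx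
  have hx0 : 0 < x := lt_of_le_of_ne hx.1 (Ne.symm h0)
  have hx1 : x < 1 := lt_of_le_of_ne hx.2 h1
  have hpi := Real.pi_pos
  constructor
  · rcases lt_or_gt_of_ne (show x ≠ 1 / 2 from h2) with h | h
    · exact (Real.cos_pos_of_mem_Ioo ⟨by nlinarith, by nlinarith⟩).ne'
    · exact (Real.cos_neg_of_pi_div_two_lt_of_lt (by nlinarith) (by nlinarith)).ne
  · exact (Real.sin_pos_of_pos_of_lt_pi (by positivity) (by nlinarith)).ne'

/-! ### Absolute convergence and integration over `z` -/

/-- Lebesgue measure on `[0, 1]³`. -/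
noncomputable abbrev unitVolume3 : Measure (ℝ × ℝ × ℝ) :=
  unitVolume.prod (unitVolume.prod unitVolume)

/-- Splits off the last coordinate `z`, the one in which the polynomial is linear and Jensen's
formula applies. -/
theorem measurePreserving_vecCons_four :
    MeasurePreserving (fun q : (ℝ × ℝ × ℝ) × ℝ => ![q.1.1, q.1.2.1, q.1.2.2, q.2])
      (unitVolume3.prod unitVolume) (volume.restrict (Icc (0 : Fin 4 → ℝ) 1)) := by
  have hmeas : Measurable (fun q : (ℝ × ℝ × ℝ) × ℝ => ![q.1.1, q.1.2.1, q.1.2.2, q.2]) := by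
    refine measurable_pi_lambda _ fun i => ?_
    fin_cases i <;> simp <;> fun_prop
  refine ⟨hmeas, ?_⟩
  have h1 : volume.restrict (Icc (0 : Fin 4 → ℝ) 1) = Measure.pi fun _ => unitVolume := by
    rw [← pi_univ_Icc, volume_pi, Measure.restrict_pi_pi]
    rfl
  rw [h1]
  symm
  refine Measure.pi_eq fun s hs => ?_
  rw [Measure.map_apply hmeas (MeasurableSet.univ_pi hs)]
  have h2 : (fun q : (ℝ × ℝ × ℝ) × ℝ => ![q.1.1, q.1.2.1, q.1.2.2, q.2]) ⁻¹' (univ.pi s)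
      = (s 0 ×ˢ (s 1 ×ˢ s 2)) ×ˢ s 3 := by
    ext q
    simp [Fin.forall_fin_succ, and_assoc]
  rw [h2, Measure.prod_prod, Measure.prod_prod, Measure.prod_prod]
  simp [Fin.prod_univ_four, mul_assoc]

/-- The coefficient of `z ^ 0` on the torus. -/
noncomputable def constCoeff (p : ℝ × ℝ × ℝ) : ℂ := (1 + unitExp p.1) * (1 + unitExp p.2.1)

/-- The coefficient of `z` on the torus. -/
noncomputable def linCoeff (p : ℝ × ℝ × ℝ) : ℂ := (1 - unitExp p.1) * (1 + unitExp p.2.2)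

@[fun_prop]
theorem continuous_constCoeff : Continuous constCoeff := by
  unfold constCoeff
  fun_prop

@[fun_prop]
theorem continuous_linCoeff : Continuous linCoeff := by
  unfold linCoeff
  fun_prop

theorem logNormOnTorus_fourVariablePolynomial (q : (ℝ × ℝ × ℝ) × ℝ) :
    logNormOnTorus fourVariablePolynomial ![q.1.1, q.1.2.1, q.1.2.2, q.2]
      = Real.log ‖constCoeff q.1 + linCoeff q.1 * unitExp q.2‖ := by
  simp [logNormOnTorus, fourVariablePolynomial, torusPoint, constCoeff, linCoeff, unitExp]

theorem measurable_logNormOnTorus {n : ℕ} (P : MvPolynomial (Fin n) ℂ) :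
    Measurable (logNormOnTorus P) := by
  have h : Continuous fun θ : Fin n → ℝ => MvPolynomial.eval (torusPoint θ) P := by
    refine (MvPolynomial.continuous_eval P).comp ?_
    unfold torusPoint
    fun_prop
  exact Real.measurable_log.comp h.norm.measurable

theorem ae_unitVolume3 :
    ∀ᵐ p ∂unitVolume3, (Real.cos (Real.pi * p.1) ≠ 0 ∧ Real.sin (Real.pi * p.1) ≠ 0) ∧
      Real.cos (Real.pi * p.2.1) ≠ 0 ∧ Real.cos (Real.pi * p.2.2) ≠ 0 := by
  have h := ae_cos_ne_zero_and_sin_ne_zero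
  filter_upwards [Measure.quasiMeasurePreserving_fst.ae h,
    (Measure.quasiMeasurePreserving_fst.comp Measure.quasiMeasurePreserving_snd).ae h,
    (Measure.quasiMeasurePreserving_snd.comp Measure.quasiMeasurePreserving_snd).ae h]
    with p h1 h2 h3
  exact ⟨h1, h2.1, h3.1⟩

theorem ae_one_add_unitExp_ne_zero :
    ∀ᵐ p ∂unitVolume3, (1 + unitExp p.1 ≠ 0 ∧ 1 - unitExp p.1 ≠ 0) ∧
      1 + unitExp p.2.1 ≠ 0 ∧ 1 + unitExp p.2.2 ≠ 0 := by
  filter_upwards [ae_unitVolume3] with p hp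
  have hadd : ∀ x, Real.cos (Real.pi * x) ≠ 0 → 1 + unitExp x ≠ 0 := fun x hx => by
    rw [← norm_ne_zero_iff, norm_one_add_unitExp]
    simpa using hx
  have hsub : ∀ x, Real.sin (Real.pi * x) ≠ 0 → 1 - unitExp x ≠ 0 := fun x hx => by
    rw [← norm_ne_zero_iff, norm_one_sub_unitExp]
    simpa using hx
  exact ⟨⟨hadd _ hp.1.1, hsub _ hp.1.2⟩, hadd _ hp.2.1, hadd _ hp.2.2⟩

theorem integrable_integral_log_norm_constCoeff :
    Integrable (fun p => Real.log ‖constCoeff p‖) unitVolume3 ∧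
      ∫ p, Real.log ‖constCoeff p‖ ∂unitVolume3 = 0 := by
  obtain ⟨hi, hv⟩ := integrable_integral_log_norm_one_add_unitExp
  have h1 : Integrable (fun p : ℝ × ℝ × ℝ => Real.log ‖1 + unitExp p.1‖) unitVolume3 :=
    hi.comp_fst _
  have h2 : Integrable (fun p : ℝ × ℝ => Real.log ‖1 + unitExp p.1‖)
    (unitVolume.prod unitVolume) := hi.comp_fst _
  have h3 : Integrable (fun p : ℝ × ℝ × ℝ => Real.log ‖1 + unitExp p.2.1‖) unitVolume3 :=
    h2.comp_snd _
  have hae : (fun p => Real.log ‖constCoeff p‖) =ᵐ[unitVolume3]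
      fun p => Real.log ‖1 + unitExp p.1‖ + Real.log ‖1 + unitExp p.2.1‖ := by
    filter_upwards [ae_one_add_unitExp_ne_zero] with p hp
    rw [constCoeff, norm_mul, Real.log_mul (norm_ne_zero_iff.2 hp.1.1) (norm_ne_zero_iff.2 hp.2.1)]
  refine ⟨(h1.add h3).congr hae.symm, ?_⟩
  rw [integral_congr_ae hae, integral_add h1 h3,
    integral_fun_fst (fun x => Real.log ‖1 + unitExp x‖), hv,
    integral_fun_snd (fun x : ℝ × ℝ => Real.log ‖1 + unitExp x.1‖),
    integral_fun_fst (fun x => Real.log ‖1 + unitExp x‖), hv]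
  simp

theorem integrable_log_norm_linCoeff :
    Integrable (fun p => Real.log ‖linCoeff p‖) unitVolume3 := by
  have h1 : Integrable (fun p : ℝ × ℝ × ℝ => Real.log ‖1 - unitExp p.1‖) unitVolume3 :=
    integrable_log_norm_one_sub_unitExp.comp_fst _
  have h2 : Integrable (fun p : ℝ × ℝ => Real.log ‖1 + unitExp p.2‖)
    (unitVolume.prod unitVolume) := integrable_integral_log_norm_one_add_unitExp.1.comp_snd _
  have h3 : Integrable (fun p : ℝ × ℝ × ℝ => Real.log ‖1 + unitExp p.2.2‖) unitVolume3 :=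
    h2.comp_snd _
  refine (h1.add h3).congr ?_
  filter_upwards [ae_one_add_unitExp_ne_zero] with p hp
  rw [linCoeff, norm_mul, Real.log_mul (norm_ne_zero_iff.2 hp.1.2) (norm_ne_zero_iff.2 hp.2.2)]
  rfl

theorem ae_constCoeff_ne_zero_and_linCoeff_ne_zero :
    ∀ᵐ p ∂unitVolume3, constCoeff p ≠ 0 ∧ linCoeff p ≠ 0 := by
  filter_upwards [ae_one_add_unitExp_ne_zero] with p hp
  exact ⟨mul_ne_zero hp.1.1 hp.2.1, mul_ne_zero hp.1.2 hp.2.2⟩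

theorem integrable_posLog_norm_div :
    Integrable (fun p => Real.posLog (‖linCoeff p‖ / ‖constCoeff p‖)) unitVolume3 := by
  refine (integrable_log_norm_linCoeff.abs.add
    integrable_integral_log_norm_constCoeff.1.abs).mono' ?_ ?_
  · exact Measurable.aestronglyMeasurable (by unfold Real.posLog; fun_prop)
  · filter_upwards [ae_constCoeff_ne_zero_and_linCoeff_ne_zero] with p hp
    rw [Real.norm_of_nonneg Real.posLog_nonneg, Real.posLog,
      Real.log_div (norm_ne_zero_iff.2 hp.2) (norm_ne_zero_iff.2 hp.1)]
    simp only [Pi.add_apply]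
    refine max_le (by positivity) ?_
    linarith [le_abs_self (Real.log ‖linCoeff p‖), neg_abs_le (Real.log ‖constCoeff p‖)]

theorem norm_add_mul_unitExp_le (p : ℝ × ℝ × ℝ) (x : ℝ) :
    ‖constCoeff p + linCoeff p * unitExp x‖ ≤ 8 := by
  have h1 : ∀ x, ‖1 + unitExp x‖ ≤ 2 := fun x => by
    refine (norm_add_le _ _).trans ?_
    rw [norm_unitExp, norm_one]
    norm_num
  have h2 : ∀ x, ‖1 - unitExp x‖ ≤ 2 := fun x => by
    refine (norm_sub_le _ _).trans ?_
    rw [norm_unitExp, norm_one]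
    norm_num
  refine (norm_add_le _ _).trans ?_
  rw [constCoeff, linCoeff, norm_mul, norm_mul, norm_mul, norm_unitExp]
  nlinarith [mul_le_mul (h1 p.1) (h1 p.2.1) (norm_nonneg _) zero_le_two,
    mul_le_mul (h2 p.1) (h1 p.2.2) (norm_nonneg _) zero_le_two]

/-- Since `log|P| ≤ log 8`, one has `|log|P|| ≤ 2 log 8 - log|P|`; Jensen's formula gives the
`z`-integral of the right side as an integrable function of the other variables. -/
theorem integrable_log_norm_add_mul_unitExp :
    Integrable (fun q : (ℝ × ℝ × ℝ) × ℝ =>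
      Real.log ‖constCoeff q.1 + linCoeff q.1 * unitExp q.2‖) (unitVolume3.prod unitVolume) := by
  have hmeas : AEStronglyMeasurable (fun q : (ℝ × ℝ × ℝ) × ℝ =>
      Real.log ‖constCoeff q.1 + linCoeff q.1 * unitExp q.2‖) (unitVolume3.prod unitVolume) :=
    Measurable.aestronglyMeasurable (by fun_prop)
  rw [integrable_prod_iff hmeas]
  constructor
  · filter_upwards [ae_constCoeff_ne_zero_and_linCoeff_ne_zero] with p hp
    exact (integrable_integral_log_norm_add_mul_unitExp hp.1 hp.2).1
  · refine (((integrable_const (2 * Real.log 8)).sub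
      integrable_integral_log_norm_constCoeff.1).sub integrable_posLog_norm_div).mono'
      hmeas.norm.integral_prod_right' ?_
    filter_upwards [ae_constCoeff_ne_zero_and_linCoeff_ne_zero] with p hp
    obtain ⟨hi, hv⟩ := integrable_integral_log_norm_add_mul_unitExp hp.1 hp.2
    rw [Real.norm_of_nonneg (integral_nonneg fun _ => norm_nonneg _)]
    have h1 : ∫ x, ‖Real.log ‖constCoeff p + linCoeff p * unitExp x‖‖ ∂unitVolume
        ≤ ∫ x, (2 * Real.log 8 - Real.log ‖constCoeff p + linCoeff p * unitExp x‖)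
          ∂unitVolume := by
      refine integral_mono hi.norm ((integrable_const _).sub hi) fun x => ?_
      have h8 : 0 ≤ Real.log 8 := Real.log_nonneg (by norm_num)
      have hle : Real.log ‖constCoeff p + linCoeff p * unitExp x‖ ≤ Real.log 8 := by
        -- At zeros of the polynomial `Real.log` takes the default value 0, so the bound needs `0 ≤
        -- log 8`.
        rcases eq_or_lt_of_le (norm_nonneg (constCoeff p + linCoeff p * unitExp x)) with h | h
        · rw [← h, Real.log_zero]
          exact h8
        · exact Real.log_le_log h (norm_add_mul_unitExp_le p x)
      rw [Real.norm_eq_abs]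
      exact abs_le.2 ⟨by linarith, by linarith⟩
    rw [integral_sub (integrable_const _) hi, hv] at h1
    simp only [integral_const, probReal_univ, one_smul] at h1
    simp only [Pi.sub_apply]
    linarith

theorem integral_log_norm_add_mul_unitExp :
    ∫ q, Real.log ‖constCoeff q.1 + linCoeff q.1 * unitExp q.2‖ ∂(unitVolume3.prod unitVolume)
      = (∫⁻ p, ENNReal.ofReal (Real.posLog (‖linCoeff p‖ / ‖constCoeff p‖)) ∂unitVolume3).toReal := by
  rw [integral_prod _ integrable_log_norm_add_mul_unitExp]
  have h1 : (fun p => ∫ x, Real.log ‖constCoeff p + linCoeff p * unitExp x‖ ∂unitVolume)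
      =ᵐ[unitVolume3]
      fun p => Real.log ‖constCoeff p‖ + Real.posLog (‖linCoeff p‖ / ‖constCoeff p‖) := by
    filter_upwards [ae_constCoeff_ne_zero_and_linCoeff_ne_zero] with p hp
    exact (integrable_integral_log_norm_add_mul_unitExp hp.1 hp.2).2
  rw [integral_congr_ae h1, integral_add integrable_integral_log_norm_constCoeff.1
    integrable_posLog_norm_div, integrable_integral_log_norm_constCoeff.2, zero_add,
    integral_eq_lintegral_of_nonneg_ae (Filter.Eventually.of_forall fun _ => Real.posLog_nonneg)
      integrable_posLog_norm_div.aestronglyMeasurable]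

/-! ### Assembling the value -/

theorem lintegral_posLog_norm_div_eq_iterated :
    ∫⁻ p, ENNReal.ofReal (Real.posLog (‖linCoeff p‖ / ‖constCoeff p‖)) ∂unitVolume3
      = ∫⁻ a in Icc (0 : ℝ) 1, ∫⁻ b in Icc (0 : ℝ) 1, ∫⁻ c in Icc (0 : ℝ) 1,
        ENNReal.ofReal (Real.posLog (|Real.tan (Real.pi * a)| *
          (|Real.cos (Real.pi * c)| / |Real.cos (Real.pi * b)|))) := by
  -- This holds even where a cosine vanishes, because division by zero gives 0 on both sides.
  have h1 : ∀ p : ℝ × ℝ × ℝ, ‖linCoeff p‖ / ‖constCoeff p‖ = |Real.tan (Real.pi * p.1)| *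
      (|Real.cos (Real.pi * p.2.2)| / |Real.cos (Real.pi * p.2.1)|) := by
    intro p
    rw [linCoeff, constCoeff, norm_mul, norm_mul, norm_one_add_unitExp, norm_one_add_unitExp,
      norm_one_add_unitExp, norm_one_sub_unitExp, Real.tan_eq_sin_div_cos, abs_div,
      mul_div_mul_comm, mul_div_mul_left _ _ two_ne_zero, mul_div_mul_left _ _ two_ne_zero]
  have hmeas : Measurable fun p : ℝ × ℝ × ℝ => ENNReal.ofReal (Real.posLog
      (|Real.tan (Real.pi * p.1)| *
        (|Real.cos (Real.pi * p.2.2)| / |Real.cos (Real.pi * p.2.1)|))) := by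
    unfold Real.posLog
    simp only [Real.tan_eq_sin_div_cos]
    fun_prop
  simp only [h1]
  rw [lintegral_prod _ hmeas.aemeasurable]
  refine lintegral_congr fun a => ?_
  exact lintegral_prod _ (hmeas.comp measurable_prodMk_left).aemeasurable

open Real in
-- Each of the three angles contributes a normalising factor `2/π` from its law, hence `8/π³`.
theorem lintegral_posLog_norm_div :
    ∫⁻ p, ENNReal.ofReal (log⁺ (‖linCoeff p‖ / ‖constCoeff p‖)) ∂unitVolume3
      = ENNReal.ofReal (8 / π ^ 3) *
        ∫⁻ v in Ioo (0 : ℝ) 1, ENNReal.ofReal ((-log v) ^ 3 / (2 * (1 + v ^ 2))) := by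
  have hmeas : ∀ a : ℝ, Measurable fun r => ENNReal.ofReal (log⁺ (a * r)) := by
    intro a
    unfold posLog
    fun_prop
  rw [lintegral_posLog_norm_div_eq_iterated, ← lintegral_cauchy_logRatio_posLog,
    lintegral_abs_tan (fun T => ∫⁻ b in Icc (0 : ℝ) 1, ∫⁻ c in Icc (0 : ℝ) 1,
      ENNReal.ofReal (log⁺ (T * (|cos (π * c)| / |cos (π * b)|)))),
    show (8 / π ^ 3) = 2 / π * (4 / π ^ 2) by field_simp; norm_num,
    ENNReal.ofReal_mul (by positivity), mul_assoc,
    ← lintegral_const_mul' (ENNReal.ofReal (4 / π ^ 2)) _ (by simp)]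
  congr 1
  refine lintegral_congr fun a => ?_
  rw [mul_left_comm]
  congr 1
  rw [← lintegral_quotient_sqrt (hmeas a),
    lintegral_abs_cos (fun U => ∫⁻ c in Icc (0 : ℝ) 1,
      ENNReal.ofReal (log⁺ (a * (|cos (π * c)| / U)))),
    show (4 / π ^ 2) = 2 / π * (2 / π) by field_simp; norm_num,
    ENNReal.ofReal_mul (by positivity), mul_assoc]
  congr 1
  rw [← lintegral_const_mul' (ENNReal.ofReal (2 / π)) _ (by simp)]
  refine lintegral_congr fun U => ?_
  rw [mul_left_comm]
  congr 1
  exact lintegral_abs_cos (fun V => ENNReal.ofReal (log⁺ (a * (V / U))))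

theorem mainTheorem11 :
    IntegrableOn (logNormOnTorus fourVariablePolynomial) (Set.Icc (0 : Fin 4 → ℝ) 1) ∧
    (multivariateLogMahlerMeasure fourVariablePolynomial : ℂ)
      = 24 / (Real.pi : ℂ) ^ 3 * LSeries (fun n : ℕ => chiNegFour n) 4 := by
  have hm := (measurable_logNormOnTorus fourVariablePolynomial)
  have hmp := measurePreserving_vecCons_four
  constructor
  · refine (hmp.integrable_comp hm.aestronglyMeasurable).1 ?_
    refine integrable_log_norm_add_mul_unitExp.congr (Filter.Eventually.of_forall fun q => ?_)
    exact (logNormOnTorus_fourVariablePolynomial q).symm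
  · rw [multivariateLogMahlerMeasure, ← hmp.map_eq,
      integral_map hmp.measurable.aemeasurable hm.aestronglyMeasurable]
    simp only [logNormOnTorus_fourVariablePolynomial]
    -- The final constant is `(8/π³) · 3`.
    rw [integral_log_norm_add_mul_unitExp, lintegral_posLog_norm_div, ENNReal.toReal_mul,
      Complex.ofReal_mul, toReal_lintegral_neg_log_pow_three,
      ENNReal.toReal_ofReal (by positivity)]
    push_cast
    ring
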